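/- Let $n,k$ be integers with $1\le k\le n/2$, and let $B_r\subset\mathbb R^n$ denote the open ball of radius $r$ centred at the origin. For $\lambda\in\mathbb R^n$ put $\sigma_i(\lambda)=\sum_{1\le j_1<\dots<j_i\le n}\lambda_{j_1}\cdots\lambda_{j_i}$ and $\Gamma_k=\{\lambda\in\mathbb R^n:\sigma_i(\lambda)\ge 0\text{ for all }1\le i\le k\}$. For a positive $C^2$ function $u$ let $A(u)$ be the symmetric matrix with entries $A_{ij}(u)=u\,u_{ij}-\tfrac12|\nabla u|^2\delta_{ij}$. For an open set $\Omega\subset\mathbb R^n$ let $\tilde\Phi^k(\Omega)$ be the set of positive $u\in C^2(\Omega)$ such that at every point of $\Omega$ the vector of eigenvalues of $A(u)$ (with multiplicities) lies in $\Gamma_k$, and let $\Phi^k(\Omega)$ be the set of (almost everywhere) positive $u\in L^1_{loc}(\Omega)$ for which there is a sequence in $\tilde\Phi^k(\Omega)$ converging to $u$ in $L^1_{loc}(\Omega)$. Then there is a constant $C>0$ depending only on $n$ and $k$ such that every $v\in\Phi^k(B_3)$ satisfies $$\sup_{B_1}v\le C\,\|v\|_{L^1(B_2)},$$ where $\sup$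 denotes the essential supremum. -/

import Mathlib

open MeasureTheory Filter Topology Metric

namespace YamabeSigma

/-- Euclidean space `ℝⁿ`. -/
abbrev E (n : ℕ) := EuclideanSpace ℝ (Fin n)

/-- The elementary symmetric function `σ_k(λ) = ∑_{i₁ < ⋯ < i_k} λ_{i₁} ⋯ λ_{i_k}`. -/
def sigma {n : ℕ} (k : ℕ) (lam : Fin n → ℝ) : ℝ :=
  ∑ s ∈ Finset.powersetCard k Finset.univ, ∏ i ∈ s, lam i

/-- The (closed) Gårding cone `Γ_k = {λ ∈ ℝⁿ : σ_i(λ) ≥ 0 for all 1 ≤ i ≤ k}`. -/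
def gardingCone (n k : ℕ) : Set (Fin n → ℝ) :=
  {lam | ∀ i, 1 ≤ i → i ≤ k → 0 ≤ sigma i lam}

/-- The Hessian matrix `(u_{ij}(x))` in the standard coordinates. -/
noncomputable def hessian {n : ℕ} (u : E n → ℝ) (x : E n) : Matrix (Fin n) (Fin n) ℝ :=
  Matrix.of fun i j => iteratedFDeriv ℝ 2 u x
    ![EuclideanSpace.basisFun (Fin n) ℝ i, EuclideanSpace.basisFun (Fin n) ℝ j]

/-- The matrix `A_{ij}(u) = u u_{ij} - ½ |∇u|² δ_{ij}` at the point `x`. -/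
noncomputable def schoutenMatrix {n : ℕ} (u : E n → ℝ) (x : E n) : Matrix (Fin n) (Fin n) ℝ :=
  u x • hessian u x - ((1 / 2 : ℝ) * ‖gradient u x‖ ^ 2) • (1 : Matrix (Fin n) (Fin n) ℝ)

/-- For `u` of class `C²` on an open set the matrix `A(u)` is symmetric there, so that its
eigenvalues are defined. -/
theorem schoutenMatrix_isHermitian {n : ℕ} {Ω : Set (E n)} (hΩ : IsOpen Ω) {u : E n → ℝ}
    (hu : ContDiffOn ℝ 2 u Ω) {x : E n} (hx : x ∈ Ω) : (schoutenMatrix u x).IsHermitian := by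
  have hs : IsSymmSndFDerivAt ℝ u x :=
    (hu.contDiffAt (hΩ.mem_nhds hx)).isSymmSndFDerivAt (by simp)
  ext i j
  by_cases hij : i = j
  · simp [hij]
  · have hji : j ≠ i := fun h => hij h.symm
    simp [schoutenMatrix, hessian, hij, hji, iteratedFDeriv_two_apply]
    exact Or.inl (hs _ _)

/-- The class `Φ̃^k(Ω)`, for open `Ω`: positive functions `u ∈ C²(Ω)` for which the vector of
eigenvalues of `A(u)(x)`, with multiplicities, lies in `Γ_k` for every `x ∈ Ω`.
The symmetry `h` in the last clause is automatic by `schoutenMatrix_isHermitian`. -/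
def PhiSmooth {n : ℕ} (k : ℕ) (Ω : Set (E n)) : Set (E n → ℝ) :=
  {u | ContDiffOn ℝ 2 u Ω ∧ (∀ x ∈ Ω, 0 < u x) ∧
    ∀ x ∈ Ω, ∃ h : (schoutenMatrix u x).IsHermitian, h.eigenvalues ∈ gardingCone n k}

/-- Convergence in `L¹_loc(Ω)`: convergence in `L¹(K)` for every compact `K ⊆ Ω`. -/
def TendstoL1Loc {n : ℕ} (Ω : Set (E n)) (w : ℕ → E n → ℝ) (u : E n → ℝ) : Prop :=
  ∀ K : Set (E n), IsCompact K → K ⊆ Ω →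
    Tendsto (fun m => eLpNorm (w m - u) 1 (volume.restrict K)) atTop (𝓝 0)

/-- The class `Φ^k(Ω)`: functions `u ∈ L¹_loc(Ω)`, positive (almost everywhere, since they are
elements of `L¹_loc`), that are limits in `L¹_loc(Ω)` of sequences in `Φ̃^k(Ω)`. -/
def Phi {n : ℕ} (k : ℕ) (Ω : Set (E n)) : Set (E n → ℝ) :=
  {u | LocallyIntegrableOn u Ω volume ∧ (∀ᵐ x ∂(volume.restrict Ω), 0 < u x) ∧
    ∃ w : ℕ → E n → ℝ, (∀ m, w m ∈ PhiSmooth k Ω) ∧ TendstoL1Loc Ω w u}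

end YamabeSigma

/-! The inequality `σ₁ ≥ 0` says that the trace of `A(u)` is nonnegative, i.e.
`u Δu ≥ (n / 2) |∇u|² ≥ 0`, so every `u ∈ Φ̃^k(Ω)` is subharmonic. For a subharmonic `f` and the
kernel `ρ(y) = (1 - |y|²)₊`, the weighted average `t ↦ ∫ f(x + t y) ρ(y) dy` is monotone on `[0, 1]`:
since `∇(ρ²) = -4 ρ y`, an integration by parts turns its derivative into
`(t / 4) ∫ Δf(x + t y) ρ(y)² dy ≥ 0` (`hasDerivAt_dilatedAverage`). Comparing `t = 0` with `t = 1`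
gives `f(x) ∫ ρ ≤ ∫ f(x + y) ρ(y) dy` (`mul_integral_radialKernel_le`), hence the estimate
`u ≤ C ‖u‖_{L¹(B₂)}` everywhere on `B₁` for `u ∈ Φ̃^k(B₃)`, with `C = (∫ ρ)⁻¹`
(`YamabeSigma.mul_integral_radialKernel_le_of_mem_phiSmooth`). Limits in `L¹_loc` inherit it almost
everywhere, along an almost everywhere convergent subsequence.
-/

open scoped Laplacian ENNReal

/-! ### The radial kernel -/

section MeanValue

variable {V : Type*} [NormedAddCommGroup V]

/-- The kernel `ρ(y) = (1 - ‖y‖²)₊`. It is chosen because its square is `C¹` with gradient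
proportional to `ρ(y) y`. -/
noncomputable def radialKernel (y : V) : ℝ := max 0 (1 - ‖y‖ ^ 2)

theorem radialKernel_nonneg (y : V) : 0 ≤ radialKernel y := le_max_left _ _

theorem radialKernel_le_one (y : V) : radialKernel y ≤ 1 :=
  max_le zero_le_one (by nlinarith [sq_nonneg ‖y‖])

theorem radialKernel_eq_zero {y : V} (hy : 1 ≤ ‖y‖) : radialKernel y = 0 :=
  max_eq_left (by nlinarith)

theorem continuous_radialKernel : Continuous (radialKernel : V → ℝ) := by
  unfold radialKernel; fun_prop

theorem hasDerivAt_sq_max_zero (s : ℝ) :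
    HasDerivAt (fun s : ℝ => (max 0 s) ^ 2) (2 * max 0 s) s := by
  rcases lt_trichotomy s 0 with hs | rfl | hs
  · rw [max_eq_left hs.le, mul_zero]
    refine (hasDerivAt_const s (0 : ℝ)).congr_of_eventuallyEq ?_
    filter_upwards [Iio_mem_nhds hs] with r hr
    simp [max_eq_left (Set.mem_Iio.1 hr).le]
  · -- at the corner the function is squeezed between `0` and `s ^ 2`
    rw [hasDerivAt_iff_isLittleO_nhds_zero]
    have h2 : (fun h : ℝ => h ^ 2) =o[𝓝 0] fun h => h := by
      simpa using Asymptotics.isLittleO_pow_id (𝕜 := ℝ) (n := 2) one_lt_two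
    refine (Asymptotics.IsBigO.of_bound 1 (Eventually.of_forall fun h => ?_)).trans_isLittleO h2
    rcases le_total 0 h with hh | hh <;> simp [hh, sq_nonneg]
  · rw [max_eq_right hs.le]
    have h := hasDerivAt_pow 2 s
    refine HasDerivAt.congr_of_eventuallyEq (by simpa using h) ?_
    filter_upwards [Ioi_mem_nhds hs] with r hr
    simp [max_eq_right (Set.mem_Ioi.1 hr).le]

variable [InnerProductSpace ℝ V]

theorem hasCompactSupport_radialKernel [FiniteDimensional ℝ V] :
    HasCompactSupport (radialKernel : V → ℝ) := by
  refine HasCompactSupport.intro (isCompact_closedBall 0 1) fun y hy => ?_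
  rw [mem_closedBall_zero_iff, not_le] at hy
  exact radialKernel_eq_zero hy.le

theorem hasCompactSupport_radialKernel_sq [FiniteDimensional ℝ V] :
    HasCompactSupport fun y : V => radialKernel y ^ 2 :=
  hasCompactSupport_radialKernel.comp_left (g := fun r : ℝ => r ^ 2) (by simp)

theorem hasFDerivAt_radialKernel_sq (y : V) :
    HasFDerivAt (fun y : V => radialKernel y ^ 2) ((-4 * radialKernel y) • innerSL ℝ y) y := by
  have h1 : HasFDerivAt (fun y : V => 1 - ‖y‖ ^ 2) (-(2 • innerSL ℝ y)) y :=
    (hasStrictFDerivAt_norm_sq y).hasFDerivAt.const_sub 1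
  have h2 := (hasDerivAt_sq_max_zero (1 - ‖y‖ ^ 2)).comp_hasFDerivAt y h1
  refine h2.congr_fderiv ?_
  ext v
  simp [radialKernel]
  ring

/-! ### Monotonicity of weighted averages of subharmonic functions -/

variable [FiniteDimensional ℝ V] [MeasurableSpace V] [BorelSpace V]

theorem integrable_mul_of_hasCompactSupport_right {h g : V → ℝ} (hh : Continuous h)
    (hg : Continuous g) (hc : HasCompactSupport g) : Integrable fun y => h y * g y :=
  (hh.mul hg).integrable_of_hasCompactSupport hc.mul_left

/-- Integration by parts in the direction `e`, with the compactly supported weight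
`radialKernel ^ 2`. -/
theorem integral_fderiv_mul_inner_mul_radialKernel {f : V → ℝ} (hf : ContDiff ℝ 2 f) (x e : V)
    (t : ℝ) :
    ∫ y, fderiv ℝ f (x + t • y) e * (inner ℝ y e * radialKernel y) =
      t / 4 * ∫ y, fderiv ℝ (fderiv ℝ f) (x + t • y) e e * radialKernel y ^ 2 := by
  have hf' : ContDiff ℝ 1 (fderiv ℝ f) := hf.fderiv_right (by norm_num)
  have hf'' : Continuous (fderiv ℝ (fderiv ℝ f)) := hf'.continuous_fderiv (by norm_num)
  have hρ : Continuous (radialKernel : V → ℝ) := continuous_radialKernel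
  have hcomp : HasCompactSupport (radialKernel : V → ℝ) := hasCompactSupport_radialKernel
  have hline (y : V) : HasFDerivAt (fun y : V => x + t • y) (t • ContinuousLinearMap.id ℝ V) y :=
    ((hasFDerivAt_id y).const_smul t).const_add x
  have hh (y : V) : HasFDerivAt (fun y => fderiv ℝ f (x + t • y) e)
      (t • (fderiv ℝ (fderiv ℝ f) (x + t • y)).flip e) y := by
    have h1 := (hf'.differentiable (by norm_num) (x + t • y)).hasFDerivAt.comp y (hline y)
    refine (h1.clm_apply (hasFDerivAt_const e y)).congr_fderiv ?_
    ext v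
    simp
  have hg := hasFDerivAt_radialKernel_sq (V := V)
  have hf'line : Continuous fun y : V => fderiv ℝ f (x + t • y) e := by
    have := hf'.continuous
    fun_prop
  have hf''line : Continuous fun y : V => fderiv ℝ (fderiv ℝ f) (x + t • y) e e := by fun_prop
  have key := integral_mul_fderiv_eq_neg_fderiv_mul_of_integrable (μ := volume)
    (f := fun y => fderiv ℝ f (x + t • y) e) (g := fun y => radialKernel y ^ 2) (v := e)
    (by
      simp only [(hh _).fderiv]
      exact integrable_mul_of_hasCompactSupport_right (by simpa using hf''line.const_mul t)
        (hρ.pow 2) hasCompactSupport_radialKernel_sq)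
    (by
      simp only [(hg _).fderiv]
      refine integrable_mul_of_hasCompactSupport_right hf'line
        (g := fun y : V => -4 * radialKernel y * inner ℝ y e) (by fun_prop) ?_
      exact (hcomp.mul_left (f := fun _ => (-4 : ℝ))).mul_right)
    (integrable_mul_of_hasCompactSupport_right hf'line (hρ.pow 2) hasCompactSupport_radialKernel_sq)
    (fun y _ => (hh y).differentiableAt) (fun y _ => (hg y).differentiableAt)
  simp only [(hh _).fderiv, (hg _).fderiv] at key
  have e1 : ∀ y : V, fderiv ℝ f (x + t • y) e * ((-4 * radialKernel y) • innerSL ℝ y) e =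
      -4 * (fderiv ℝ f (x + t • y) e * (inner ℝ y e * radialKernel y)) := fun y => by
    simp; ring
  have e2 : ∀ y : V, (t • (fderiv ℝ (fderiv ℝ f) (x + t • y)).flip e) e * radialKernel y ^ 2 =
      t * (fderiv ℝ (fderiv ℝ f) (x + t • y) e e * radialKernel y ^ 2) := fun y => by
    simp; ring
  simp only [e1, e2, integral_const_mul] at key
  linarith

/-- The derivative of the weighted average over dilated balls. -/
theorem hasDerivAt_dilatedAverage {f : V → ℝ} (hf : ContDiff ℝ 2 f) (hc : HasCompactSupport f)
    (x : V) (t : ℝ) :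
    HasDerivAt (fun t : ℝ => ∫ y, f (x + t • y) * radialKernel y)
      (t / 4 * ∫ y, Δ f (x + t • y) * radialKernel y ^ 2) t := by
  have hf' : ContDiff ℝ 1 (fderiv ℝ f) := hf.fderiv_right (by norm_num)
  have hf'c : Continuous (fderiv ℝ f) := hf'.continuous
  have hf'' : Continuous (fderiv ℝ (fderiv ℝ f)) := hf'.continuous_fderiv (by norm_num)
  have hfc : Continuous f := hf.continuous
  have hρ : Continuous (radialKernel : V → ℝ) := continuous_radialKernel
  have hcomp : HasCompactSupport (radialKernel : V → ℝ) := hasCompactSupport_radialKernel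
  obtain ⟨L, hL⟩ := (hc.fderiv (𝕜 := ℝ)).exists_bound_of_continuous hf'c
  have hint (s : ℝ) : Integrable fun y : V => f (x + s • y) * radialKernel y :=
    integrable_mul_of_hasCompactSupport_right (by fun_prop) hρ hcomp
  obtain ⟨-, hderiv⟩ := hasDerivAt_integral_of_dominated_loc_of_deriv_le (μ := (volume : Measure V))
    (F := fun (t : ℝ) y => f (x + t • y) * radialKernel y)
    (F' := fun (t : ℝ) y => fderiv ℝ f (x + t • y) y * radialKernel y)
    (bound := fun y => (L * ‖y‖) * radialKernel y) (x₀ := t) (s := Set.univ) univ_mem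
    (Eventually.of_forall fun s => (hint s).aestronglyMeasurable) (hint t)
    (Continuous.aestronglyMeasurable (by fun_prop))
    (Eventually.of_forall fun y s _ => by
      rw [norm_mul, Real.norm_of_nonneg (radialKernel_nonneg y)]
      refine mul_le_mul_of_nonneg_right ?_ (radialKernel_nonneg y)
      exact (ContinuousLinearMap.le_opNorm _ _).trans
        (mul_le_mul_of_nonneg_right (hL _) (norm_nonneg _)))
    (integrable_mul_of_hasCompactSupport_right (by fun_prop) hρ hcomp)
    (Eventually.of_forall fun y s _ => by
      have h1 : HasDerivAt (fun s : ℝ => x + s • y) y s := by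
        simpa using ((hasDerivAt_id s).smul_const y).const_add x
      exact ((hf.differentiable (by norm_num) (x + s • y)).hasFDerivAt.comp_hasDerivAt s
        h1).mul_const _)
  refine hderiv.congr_deriv ?_
  set b := stdOrthonormalBasis ℝ V
  have hsum (y : V) : fderiv ℝ f (x + t • y) y * radialKernel y =
      ∑ i, fderiv ℝ f (x + t • y) (b i) * (inner ℝ y (b i) * radialKernel y) := by
    conv_lhs => rw [← b.sum_repr' y, map_sum, Finset.sum_mul]
    refine Finset.sum_congr rfl fun i _ => ?_
    rw [b.sum_repr' y, map_smul, smul_eq_mul, real_inner_comm]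
    ring
  have hlap (y : V) : Δ f (x + t • y) * radialKernel y ^ 2 =
      ∑ i, fderiv ℝ (fderiv ℝ f) (x + t • y) (b i) (b i) * radialKernel y ^ 2 := by
    rw [InnerProductSpace.laplacian_eq_iteratedFDeriv_orthonormalBasis f b, Finset.sum_mul]
    simp [iteratedFDeriv_two_apply]
  simp only [hsum, hlap]
  rw [integral_finsetSum, integral_finsetSum, Finset.mul_sum]
  · exact Finset.sum_congr rfl fun i _ => integral_fderiv_mul_inner_mul_radialKernel hf x (b i) t
  · exact fun i _ => integrable_mul_of_hasCompactSupport_right (by fun_prop) (by fun_prop) hasCompactSupport_radialKernel_sq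
  · exact fun i _ => integrable_mul_of_hasCompactSupport_right (by fun_prop) (by fun_prop)
      hcomp.mul_left

/-- Mean value inequality for functions that are subharmonic on a unit ball. -/
theorem mul_integral_radialKernel_le {f : V → ℝ} (hf : ContDiff ℝ 2 f) (hc : HasCompactSupport f)
    {x : V} (hlap : ∀ z ∈ ball x 1, 0 ≤ Δ f z) :
    f x * ∫ y : V, radialKernel y ≤ ∫ y, f (x + y) * radialKernel y := by
  have hd := hasDerivAt_dilatedAverage hf hc x
  have hmono : MonotoneOn (fun t : ℝ => ∫ y, f (x + t • y) * radialKernel y) (Set.Icc 0 1) := by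
    refine monotoneOn_of_deriv_nonneg (convex_Icc 0 1)
      (fun t _ => (hd t).continuousAt.continuousWithinAt)
      (fun t _ => (hd t).differentiableAt.differentiableWithinAt) fun t ht => ?_
    rw [interior_Icc] at ht
    rw [(hd t).deriv]
    refine mul_nonneg (by linarith [ht.1]) (integral_nonneg fun y => ?_)
    rcases le_or_gt 1 ‖y‖ with hy | hy
    · simp [radialKernel_eq_zero hy]
    · refine mul_nonneg (hlap _ ?_) (sq_nonneg _)
      rw [mem_ball_iff_norm, add_sub_cancel_left, norm_smul, Real.norm_of_nonneg ht.1.le]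
      nlinarith [ht.1, ht.2, norm_nonneg y]
  have h := hmono (Set.left_mem_Icc.2 zero_le_one) (Set.right_mem_Icc.2 zero_le_one) zero_le_one
  simpa [integral_const_mul] using h

theorem integral_radialKernel_pos : 0 < ∫ y : V, radialKernel y := by
  refine continuous_radialKernel.integral_pos_of_hasCompactSupport_nonneg_nonzero
    hasCompactSupport_radialKernel radialKernel_nonneg (x := 0) ?_
  simp [radialKernel]

end MeanValue

/-! ### Subharmonicity and the estimate for smooth functions -/

namespace YamabeSigma

theorem sigma_one {n : ℕ} (lam : Fin n → ℝ) : sigma 1 lam = ∑ i, lam i := by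
  simp [sigma, Finset.powersetCard_one]

theorem laplacian_eq_trace_hessian {n : ℕ} (u : E n → ℝ) (x : E n) :
    Δ u x = (hessian u x).trace := by
  rw [InnerProductSpace.laplacian_eq_iteratedFDeriv_orthonormalBasis u
    (EuclideanSpace.basisFun (Fin n) ℝ)]
  rfl

/-- Functions in `Φ̃^k(Ω)` are subharmonic: `σ₁ ≥ 0` bounds `u Δu` below by `(n / 2) |∇u|²`. -/
theorem laplacian_nonneg_of_mem_phiSmooth {n k : ℕ} (hk : 1 ≤ k) {Ω : Set (E n)} {u : E n → ℝ}
    (hu : u ∈ PhiSmooth k Ω) {x : E n} (hx : x ∈ Ω) : 0 ≤ Δ u x := by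
  obtain ⟨-, hpos, hcone⟩ := hu
  obtain ⟨h, hΓ⟩ := hcone x hx
  have h1 := hΓ 1 le_rfl hk
  have htr := h.trace_eq_sum_eigenvalues
  simp only [RCLike.ofReal_real_eq_id, id_eq] at htr
  rw [sigma_one, ← htr] at h1
  simp only [schoutenMatrix, Matrix.trace_sub, Matrix.trace_smul, Matrix.trace_one,
    Fintype.card_fin, smul_eq_mul] at h1
  rw [laplacian_eq_trace_hessian]
  refine nonneg_of_mul_nonneg_right (a := u x) ?_ (hpos x hx)
  have : 0 ≤ 1 / 2 * ‖gradient u x‖ ^ 2 * (n : ℝ) := by positivity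
  linarith

/-- The interior estimate, at every point, for smooth functions. -/
theorem mul_integral_radialKernel_le_of_mem_phiSmooth {n k : ℕ} (hk : 1 ≤ k) {u : E n → ℝ}
    (hu : u ∈ PhiSmooth k (ball (0 : E n) 3)) {x : E n} (hx : x ∈ ball (0 : E n) 1) :
    u x * ∫ y : E n, radialKernel y ≤ ∫ y in ball (0 : E n) 2, u y := by
  -- a cutoff makes `u` globally `C²` with compact support, without changing it on `B₂`
  let η : ContDiffBump (0 : E n) := ⟨2, 5 / 2, by norm_num, by norm_num⟩
  let f : E n → ℝ := fun y => η y * u y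
  have hsupp : tsupport f ⊆ ball 0 3 := by
    refine (tsupport_mul_subset_left (f := η) (g := u)).trans ?_
    rw [η.tsupport_eq]
    exact closedBall_subset_ball (by norm_num [η])
  have hf : ContDiff ℝ 2 f := by
    refine contDiff_iff_contDiffAt.2 fun y => ?_
    by_cases hy : y ∈ tsupport f
    · exact η.contDiffAt.mul (hu.1.contDiffAt (isOpen_ball.mem_nhds (hsupp hy)))
    · exact contDiffAt_const.congr_of_eventuallyEq (notMem_tsupport_iff_eventuallyEq.1 hy)
  have hc : HasCompactSupport f := η.hasCompactSupport.mul_right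
  have hfu : ∀ y ∈ ball (0 : E n) 2, f y = u y := fun y hy => by
    simp [f, η.one_of_mem_closedBall (ball_subset_closedBall hy)]
  have hadd : ∀ z ∈ ball x 1, z ∈ ball (0 : E n) 2 := fun z hz => by
    rw [mem_ball] at hz hx ⊢
    linarith [dist_triangle z x 0]
  have hlap : ∀ z ∈ ball x 1, 0 ≤ Δ f z := fun z hz => by
    have heq : f =ᶠ[𝓝 z] u := by
      filter_upwards [isOpen_ball.mem_nhds (hadd z hz)] with y hy using hfu y hy
    rw [(InnerProductSpace.laplacian_congr_nhds heq).self_of_nhds]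
    exact laplacian_nonneg_of_mem_phiSmooth hk hu (ball_subset_ball (by norm_num) (hadd z hz))
  have hmv := mul_integral_radialKernel_le hf hc hlap
  rw [hfu x (ball_subset_ball (by norm_num) hx)] at hmv
  refine hmv.trans ?_
  rw [← integral_indicator measurableSet_ball, ← integral_add_left_eq_self ((ball (0 : E n) 2).indicator u) x]
  have hI : Integrable ((ball (0 : E n) 2).indicator u) := by
    rw [integrable_indicator_iff measurableSet_ball]
    refine IntegrableOn.mono_set ?_ ball_subset_closedBall
    exact (hu.1.continuousOn.mono (closedBall_subset_ball (by norm_num))).integrableOn_compact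
      (isCompact_closedBall 0 2)
  refine integral_mono ?_ (hI.comp_add_left x) fun y => ?_
  · have := hf.continuous
    exact integrable_mul_of_hasCompactSupport_right (by fun_prop) continuous_radialKernel
      hasCompactSupport_radialKernel
  · dsimp only
    have hnn : 0 ≤ (ball (0 : E n) 2).indicator u (x + y) :=
      Set.indicator_nonneg (fun z hz => (hu.2.1 z (ball_subset_ball (by norm_num) hz)).le) _
    rcases le_or_gt 1 ‖y‖ with hy | hy
    · simpa [radialKernel_eq_zero hy] using hnn
    · have hmem : x + y ∈ ball (0 : E n) 2 := hadd _ (by simpa [mem_ball_iff_norm] using hy)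
      rw [Set.indicator_of_mem hmem] at hnn ⊢
      rw [hfu _ hmem]
      exact mul_le_of_le_one_right hnn (radialKernel_le_one y)

theorem enorm_le_of_mem_phiSmooth {n k : ℕ} (hk : 1 ≤ k) {u : E n → ℝ}
    (hu : u ∈ PhiSmooth k (ball (0 : E n) 3)) {x : E n} (hx : x ∈ ball (0 : E n) 1) :
    ‖u x‖ₑ ≤ ENNReal.ofReal (∫ y : E n, radialKernel y)⁻¹ *
      eLpNorm u 1 (volume.restrict (ball 0 2)) := by
  have hpos : ∀ y ∈ ball (0 : E n) 2, 0 < u y := fun y hy =>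
    hu.2.1 y (ball_subset_ball (by norm_num) hy)
  have hI : IntegrableOn u (ball (0 : E n) 2) := by
    refine IntegrableOn.mono_set ?_ ball_subset_closedBall
    exact (hu.1.continuousOn.mono (closedBall_subset_ball (by norm_num))).integrableOn_compact
      (isCompact_closedBall 0 2)
  have hK := integral_radialKernel_pos (V := E n)
  have hnorm : eLpNorm u 1 (volume.restrict (ball 0 2)) =
      ENNReal.ofReal (∫ y in ball (0 : E n) 2, u y) := by
    rw [eLpNorm_one_eq_lintegral_enorm, ← ofReal_integral_norm_eq_lintegral_enorm hI]
    congr 1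
    exact setIntegral_congr_fun measurableSet_ball fun y hy =>
      Real.norm_of_nonneg (hpos y hy).le
  rw [hnorm, ← ENNReal.ofReal_mul (inv_nonneg.2 hK.le),
    Real.enorm_of_nonneg (hpos x (ball_subset_ball (by norm_num) hx)).le]
  refine ENNReal.ofReal_le_ofReal ?_
  rw [inv_mul_eq_div, le_div_iff₀ hK]
  exact mul_integral_radialKernel_le_of_mem_phiSmooth hk hu hx

end YamabeSigma

/-! ### Passage to the limit -/

/-- Interior `L^∞`-`L¹` estimate. As `v > 0` almost everywhere, the `L^∞(B₁)` norm on the left,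
with values in `[0, ∞]`, is the (essential) supremum of `v` over `B₁`. -/
theorem lemma5p1 (n k : ℕ) (hk : 1 ≤ k) (hkn : 2 * k ≤ n) :
    ∃ C : ℝ, 0 < C ∧
      ∀ v ∈ YamabeSigma.Phi k (Metric.ball (0 : EuclideanSpace ℝ (Fin n)) 3),
        eLpNorm v ⊤ (volume.restrict (Metric.ball 0 1)) ≤
          ENNReal.ofReal C * eLpNorm v 1 (volume.restrict (Metric.ball 0 2)) := by
  open YamabeSigma in
  have hK := integral_radialKernel_pos (V := E n)
  refine ⟨_, inv_pos.2 hK, ?_⟩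
  rintro v ⟨hv, -, w, hw, hlim⟩
  have hsub : closedBall (0 : E n) 2 ⊆ ball 0 3 := closedBall_subset_ball (by norm_num)
  have hcpt := isCompact_closedBall (0 : E n) 2
  have hmono : volume.restrict (ball (0 : E n) 2) ≤ volume.restrict (closedBall 0 2) :=
    Measure.restrict_mono ball_subset_closedBall le_rfl
  have hmono' : volume.restrict (ball (0 : E n) 1) ≤ volume.restrict (ball 0 2) :=
    Measure.restrict_mono (ball_subset_ball (by norm_num)) le_rfl
  have hvm : AEStronglyMeasurable v (volume.restrict (ball (0 : E n) 2)) :=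
    ((hv.integrableOn_compact_subset hsub hcpt).aestronglyMeasurable).mono_measure hmono
  have hwm (m : ℕ) : AEStronglyMeasurable (w m) (volume.restrict (ball (0 : E n) 2)) :=
    (((hw m).1.continuousOn.mono hsub).aestronglyMeasurable
      isClosed_closedBall.measurableSet).mono_measure hmono
  have hL1 : Tendsto (fun m => eLpNorm (w m - v) 1 (volume.restrict (ball (0 : E n) 2)))
      atTop (𝓝 0) :=
    tendsto_of_tendsto_of_tendsto_of_le_of_le tendsto_const_nhds (hlim _ hcpt hsub)
      (fun _ => zero_le) fun m => eLpNorm_mono_measure _ hmono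
  obtain ⟨ns, hns, hae⟩ :=
    (tendstoInMeasure_of_tendsto_eLpNorm one_ne_zero hwm hvm hL1).exists_seq_tendsto_ae
  have htri (m : ℕ) : eLpNorm (w m) 1 (volume.restrict (ball (0 : E n) 2)) ≤
      eLpNorm (w m - v) 1 (volume.restrict (ball 0 2)) +
        eLpNorm v 1 (volume.restrict (ball 0 2)) := by
    simpa using eLpNorm_add_le ((hwm m).sub hvm) hvm le_rfl
  have hbound : Tendsto (fun m => eLpNorm (w (ns m) - v) 1 (volume.restrict (ball (0 : E n) 2)) +
      eLpNorm v 1 (volume.restrict (ball 0 2))) atTop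
      (𝓝 (eLpNorm v 1 (volume.restrict (ball 0 2)))) := by
    simpa using (hL1.comp hns.tendsto_atTop).add_const _
  rw [eLpNorm_exponent_top]
  refine eLpNormEssSup_le_of_ae_enorm_bound ?_
  filter_upwards [ae_mono hmono' hae, ae_restrict_mem measurableSet_ball] with x hx hx1
  refine le_of_tendsto_of_tendsto' hx.enorm
    (ENNReal.Tendsto.const_mul hbound (Or.inr ENNReal.ofReal_ne_top)) fun m => ?_
  exact (enorm_le_of_mem_phiSmooth hk (hw (ns m)) hx1).trans
    (mul_le_mul_right (htri (ns m)) _)
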